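/- Let $\mathcal H$ be a real Hilbert space, let $q := \tfrac12\|\cdot\|^2$, let $T\colon \mathcal H\to\mathcal H$, and set $f := q\circ T$. A set $K\subseteq\mathcal H$ is a cone if $\lambda x\in K$ for all $x\in K$ and all real $\lambda>0$; for a nonempty closed convex set $K$, the projector $P_K$ maps each $x\in\mathcal H$ to the unique point of $K$ nearest to $x$. Then the following are equivalent: (i) There exists a nonempty closed convex cone $K\subseteq\mathcal H$ such that $T=P_K$. (ii) $T$ is monotone, i.e., $\langle Tx-Ty,\,x-y\rangle\ge 0$ for all $x,y\in\mathcal H$; $T$ is positively homogeneous, i.e., $T(\lambda x)=\lambda Tx$ for all $x\in\mathcal H$ and all real $\lambda>0$; $f$ is Gâteaux differentiable on $\mathcal H$, i.e., at each $x\in\mathcal H$ there is a bounded linear functional $L$ on $\mathcal H$ such that, for every $v\in\mathcal H$, the derivative at $t=0$ of $t\mapsto f(x+tv)$ exists and equals $L(v)$; and $\nabla f=T$, i.e., this functional is $L=\langle Tx,\cdot\rangle$ for every $x\in\mathcal H$. If (i) or (ii) holds, then $\operatorname{ran}T$ is a nonempty closed convex cone with $T=P_{\operatorname{ran}T}$,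 and every nonempty closed convex cone $K$ with $T=P_K$ satisfies $K=\operatorname{ran}T$. -/

import Mathlib

namespace ProjCone

variable {H : Type*} [NormedAddCommGroup H] [InnerProductSpace ℝ H]

/-- The function `q = (1/2) ‖·‖ ^ 2`. -/
noncomputable def q (x : H) : ℝ := (1 / 2) * ‖x‖ ^ 2

/-- `K` is a cone: it is stable under multiplication by strictly positive scalars. -/
def IsCone (K : Set H) : Prop := ∀ x ∈ K, ∀ c : ℝ, 0 < c → c • x ∈ K

/-- `K` is a nonempty closed convex cone. -/
structure IsNonemptyClosedConvexCone (K : Set H) : Prop where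
  nonempty : K.Nonempty
  isClosed : IsClosed K
  convex : Convex ℝ K
  isCone : IsCone K

/-- `p` is a nearest point to `x` in `C`. -/
def IsNearestPoint (C : Set H) (x p : H) : Prop := p ∈ C ∧ ∀ y ∈ C, ‖x - p‖ ≤ ‖x - y‖

/-- In a Hilbert space every point has exactly one nearest point in a nonempty closed convex set. -/
theorem existsUnique_isNearestPoint [CompleteSpace H] {C : Set H} (hne : C.Nonempty)
    (hcl : IsClosed C) (hcv : Convex ℝ C) (x : H) : ∃! p, IsNearestPoint C x p := by
  have key : ∀ p, IsNearestPoint C x p → ∀ w ∈ C, inner ℝ (x - p) (w - p) ≤ 0 := by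
    intro p hp
    refine (norm_eq_iInf_iff_real_inner_le_zero hcv hp.1).1 ?_
    have : Nonempty C := hne.to_subtype
    refine le_antisymm (le_ciInf fun w => hp.2 w w.2) ?_
    exact ciInf_le ⟨0, by rintro _ ⟨w, rfl⟩; exact norm_nonneg _⟩ (⟨p, hp.1⟩ : C)
  obtain ⟨p, hpC, hp⟩ := exists_norm_eq_iInf_of_complete_convex hne hcl.isComplete hcv x
  have hpn : IsNearestPoint C x p := by
    refine ⟨hpC, fun y hy => ?_⟩
    rw [hp]
    exact ciInf_le ⟨0, by rintro _ ⟨w, rfl⟩; exact norm_nonneg _⟩ (⟨y, hy⟩ : C)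
  refine ⟨p, hpn, fun r hr => ?_⟩
  have h1 := key p hpn r hr.1
  have h2 := key r hr p hpC
  have h3 : inner ℝ (r - p) (r - p) = inner ℝ (x - p) (r - p) + inner ℝ (x - r) (p - r) := by
    simp only [inner_sub_left, inner_sub_right]
    ring
  have h4 : inner ℝ (r - p) (r - p) ≤ 0 := by linarith
  exact sub_eq_zero.1 (real_inner_self_nonpos.1 h4)

/-- `T = P_C`: the operator `T` sends every point to its nearest point in `C`. -/
def IsProjectorOnto (C : Set H) (T : H → H) : Prop := ∀ x, IsNearestPoint C x (T x)

/-- `T` is monotone in the sense of monotone operator theory. -/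
def IsMonotoneOperator (T : H → H) : Prop := ∀ x y, 0 ≤ inner ℝ (T x - T y) (x - y)

/-- `T` is positively homogeneous; nothing is required of `T 0`. -/
def IsPosHomogeneous (T : H → H) : Prop := ∀ x, ∀ c : ℝ, 0 < c → T (c • x) = c • T x

/-- The bounded linear functional `L` is the Gâteaux derivative of `f` at `x`: for every
direction `v`, the derivative of `t ↦ f (x + t • v)` at `0` is `L v`. -/
def HasGateauxDerivAt (f : H → ℝ) (L : H →L[ℝ] ℝ) (x : H) : Prop :=
  ∀ v, HasLineDerivAt ℝ f (L v) x v

/-- `f` is Gâteaux differentiable on the whole space. -/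
def GateauxDifferentiable (f : H → ℝ) : Prop :=
  ∀ x, ∃ L : H →L[ℝ] ℝ, HasGateauxDerivAt f L x

/-- `∇f(x) = g`: the Gâteaux derivative of `f` at `x` exists and is `⟨g, ·⟩`. -/
def HasGateauxGradientAt (f : H → ℝ) (g x : H) : Prop :=
  HasGateauxDerivAt f (innerSL ℝ g) x

end ProjCone

/-! For a projector onto a cone, `⟨x, T x⟩ = ‖T x‖²` and `⟨x, k⟩ ≤ ⟨T x, k⟩` on `K`; they yield
homogeneity and the gradient inequality for `f = q ∘ T`, and nonexpansiveness upgrades the latter to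
a derivative. Conversely, Euler's identity turns the gradient inequality for `f` into `⟨T x, y⟩ ≤ q
(T x) + q (T y)`, which makes `T x` nearest to `x` in the closure of the range. Only convexity of
that closure is delicate: solving `T z + ε z = u` shows that it contains the domain of the conjugate
`f*`, which is convex and contains the range. A projector fixes its target pointwise, so the target
is the range. -/

namespace ProjCone

/-! ### Minimization and nearest points -/

section General

variable {H : Type*} [NormedAddCommGroup H] [InnerProductSpace ℝ H]

/-- A lower bounded continuous function satisfying a quadratic midpoint inequality attains its
infimum. -/
theorem exists_forall_le_of_midpoint [CompleteSpace H] {g : H → ℝ} (hg : Continuous g)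
    (hb : BddBelow (Set.range g)) {c : ℝ} (hc : 0 < c)
    (hmid : ∀ a b, 2 * g ((1 / 2 : ℝ) • (a + b)) + c * ‖a - b‖ ^ 2 ≤ g a + g b) :
    ∃ z, ∀ y, g z ≤ g y := by
  set m := ⨅ y, g y
  have hm : ∀ y, m ≤ g y := fun y => ciInf_le hb y
  have hex : ∀ n : ℕ, ∃ z, g z < m + 1 / ((n : ℝ) + 1) := fun n =>
    exists_lt_of_ciInf_lt (lt_add_of_pos_right m Nat.one_div_pos_of_nat)
  choose z hz using hex
  have hcauchy : CauchySeq z := by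
    rw [Metric.cauchySeq_iff']
    intro δ hδ
    -- The midpoint inequality gives `c * ‖z n - z N‖ ^ 2 ≤ 1 / (n + 1) + 1 / (N + 1)`.
    obtain ⟨N, hN⟩ := exists_nat_one_div_lt (K := ℝ) (ε := c * δ ^ 2 / 2) (by positivity)
    refine ⟨N, fun n hn => ?_⟩
    have h1 := hmid (z n) (z N)
    have h2 := hm ((1 / 2 : ℝ) • (z n + z N))
    have h3 := hz n
    have h4 := hz N
    have h5 : 1 / ((n : ℝ) + 1) ≤ 1 / ((N : ℝ) + 1) := Nat.one_div_le_one_div hn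
    have h6 : c * ‖z n - z N‖ ^ 2 < c * δ ^ 2 := by linarith
    rw [dist_eq_norm]
    exact lt_of_pow_lt_pow_left₀ 2 hδ.le (lt_of_mul_lt_mul_left h6 hc.le)
  obtain ⟨w, hw⟩ := cauchySeq_tendsto_of_complete hcauchy
  refine ⟨w, fun y => le_trans ?_ (hm y)⟩
  have h1 : Filter.Tendsto (fun n => g (z n)) Filter.atTop (nhds (g w)) :=
    (hg.tendsto w).comp hw
  have h2 : Filter.Tendsto (fun n : ℕ => m + 1 / ((n : ℝ) + 1)) Filter.atTop (nhds m) := by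
    simpa using tendsto_one_div_add_atTop_nhds_zero_nat.const_add m
  exact le_of_tendsto_of_tendsto' h1 h2 fun n => (hz n).le

theorem IsNearestPoint.inner_le_zero {C : Set H} (hcv : Convex ℝ C) {x p : H}
    (hp : IsNearestPoint C x p) {w : H} (hw : w ∈ C) : inner ℝ (x - p) (w - p) ≤ 0 := by
  have : Nonempty C := ⟨⟨p, hp.1⟩⟩
  refine (norm_eq_iInf_iff_real_inner_le_zero hcv hp.1).1 ?_ w hw
  refine le_antisymm (le_ciInf fun w => hp.2 w w.2) ?_
  exact ciInf_le ⟨0, by rintro _ ⟨w, rfl⟩; exact norm_nonneg _⟩ (⟨p, hp.1⟩ : C)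

omit [InnerProductSpace ℝ H] in
theorem IsProjectorOnto.eq_range {K : Set H} {T : H → H} (hT : IsProjectorOnto K T) :
    K = Set.range T := by
  ext k
  constructor
  · intro hk
    have h := (hT k).2 k hk
    rw [sub_self, norm_zero] at h
    exact ⟨k, (sub_eq_zero.1 (norm_le_zero_iff.1 h)).symm⟩
  · rintro ⟨x, rfl⟩
    exact (hT x).1

/-- A point `p` with `⟨x, p⟩ = ‖p‖²` and `⟨x, k⟩ ≤ q p + q k` on `C` is nearest to `x`. -/
theorem isNearestPoint_of_inner_le {C : Set H} {x p : H} (hp : p ∈ C)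
    (hxp : inner ℝ x p = ‖p‖ ^ 2) (h : ∀ k ∈ C, inner ℝ x k ≤ q p + q k) :
    IsNearestPoint C x p := by
  refine ⟨hp, fun k hk => le_of_abs_le (abs_le_of_sq_le_sq ?_ (norm_nonneg _))⟩
  have h1 := h k hk
  rw [norm_sub_sq_real, norm_sub_sq_real, hxp]
  unfold q at h1
  linarith

end General

/-! ### From projectors onto cones to gradients -/

section Projector

variable {H : Type*} [NormedAddCommGroup H] [InnerProductSpace ℝ H] {K : Set H} {T : H → H}

theorem IsNonemptyClosedConvexCone.zero_mem (hK : IsNonemptyClosedConvexCone K) :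
    (0 : H) ∈ K := by
  obtain ⟨k, hk⟩ := hK.nonempty
  refine hK.isClosed.mem_of_tendsto (b := Filter.atTop)
    (f := fun n : ℕ => (1 / ((n : ℝ) + 1)) • k) ?_
    (Filter.Eventually.of_forall fun n => hK.isCone k hk _ Nat.one_div_pos_of_nat)
  simpa using (tendsto_one_div_add_atTop_nhds_zero_nat (𝕜 := ℝ)).smul_const k

/-- Testing the obtuse-angle inequality at `0` and at `2 • T x` gives both signs of `⟨x - T x, T
x⟩`. -/
theorem IsProjectorOnto.inner_self (hK : IsNonemptyClosedConvexCone K)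
    (hT : IsProjectorOnto K T) (x : H) : inner ℝ x (T x) = ‖T x‖ ^ 2 := by
  have h0 := (hT x).inner_le_zero hK.convex hK.zero_mem
  have h2 := (hT x).inner_le_zero hK.convex (hK.isCone _ (hT x).1 2 two_pos)
  simp only [inner_sub_left, inner_sub_right, inner_zero_right, real_inner_smul_right,
    real_inner_self_eq_norm_sq] at h0 h2
  linarith

theorem IsProjectorOnto.inner_le (hK : IsNonemptyClosedConvexCone K)
    (hT : IsProjectorOnto K T) (x : H) {k : H} (hk : k ∈ K) :
    inner ℝ x k ≤ inner ℝ (T x) k := by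
  have h1 := (hT x).inner_le_zero hK.convex hk
  have h2 := hT.inner_self hK x
  simp only [inner_sub_left, inner_sub_right, real_inner_self_eq_norm_sq] at h1
  linarith

theorem inner_le_q_add_q (a b : H) : inner ℝ a b ≤ q a + q b := by
  have h := sq_nonneg ‖a - b‖
  rw [norm_sub_sq_real] at h
  unfold q
  linarith

theorem IsProjectorOnto.norm_sub_sq_le (hcv : Convex ℝ K) (hT : IsProjectorOnto K T) (x y : H) :
    ‖T x - T y‖ ^ 2 ≤ inner ℝ (T x - T y) (x - y) := by
  have h1 := (hT x).inner_le_zero hcv (hT y).1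
  have h2 := (hT y).inner_le_zero hcv (hT x).1
  rw [← real_inner_self_eq_norm_sq]
  simp only [inner_sub_left, inner_sub_right] at h1 h2 ⊢
  linarith [real_inner_comm x (T x), real_inner_comm x (T y), real_inner_comm y (T x),
    real_inner_comm y (T y), real_inner_comm (T x) (T y)]

theorem IsProjectorOnto.isMonotoneOperator (hcv : Convex ℝ K) (hT : IsProjectorOnto K T) :
    IsMonotoneOperator T := fun x y => (sq_nonneg _).trans (hT.norm_sub_sq_le hcv x y)

theorem IsProjectorOnto.norm_sub_le (hcv : Convex ℝ K) (hT : IsProjectorOnto K T) (x y : H) :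
    ‖T x - T y‖ ≤ ‖x - y‖ := by
  have h1 := hT.norm_sub_sq_le hcv x y
  have h2 := real_inner_le_norm (T x - T y) (x - y)
  by_contra! h
  have h3 : 0 < ‖T x - T y‖ := (norm_nonneg _).trans_lt h
  nlinarith

theorem IsProjectorOnto.isPosHomogeneous [CompleteSpace H] (hK : IsNonemptyClosedConvexCone K)
    (hT : IsProjectorOnto K T) : IsPosHomogeneous T := by
  intro x c hc
  refine (existsUnique_isNearestPoint hK.nonempty hK.isClosed hK.convex (c • x)).unique
    (hT _) (isNearestPoint_of_inner_le (hK.isCone _ (hT x).1 c hc) ?_ fun k hk => ?_)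
  · rw [real_inner_smul_left, real_inner_smul_right, hT.inner_self hK, norm_smul,
      Real.norm_of_nonneg hc.le]
    ring
  · refine le_trans ?_ (inner_le_q_add_q _ _)
    rw [real_inner_smul_left, real_inner_smul_left]
    exact mul_le_mul_of_nonneg_left (hT.inner_le hK x hk) hc.le

theorem IsProjectorOnto.q_comp_add_inner_le (hK : IsNonemptyClosedConvexCone K)
    (hT : IsProjectorOnto K T) (x y : H) :
    q (T x) + inner ℝ (T x) (y - x) ≤ q (T y) := by
  have h1 := hT.inner_le hK y (hT x).1
  have h2 := inner_le_q_add_q (T y) (T x)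
  have h3 := hT.inner_self hK x
  have h4 : 2 * q (T x) = ‖T x‖ ^ 2 := by unfold q; ring
  rw [inner_sub_right, real_inner_comm y (T x), real_inner_comm x (T x)]
  linarith

/-- The gradient inequalities at `x` and at `y` trap the remainder between `0` and `⟨T y - T x, y -
x⟩ ≤ ‖y - x‖ ^ 2`. -/
theorem IsProjectorOnto.hasFDerivAt (hK : IsNonemptyClosedConvexCone K)
    (hT : IsProjectorOnto K T) (x : H) : HasFDerivAt (q ∘ T) (innerSL ℝ (T x)) x := by
  refine HasFDerivAt.of_isLittleO (Asymptotics.IsBigO.trans_isLittleO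
    (g := fun y => ‖y - x‖ ^ 2) (Asymptotics.IsBigO.of_bound 1
      (Filter.Eventually.of_forall fun y => ?_)) ?_)
  · have h1 := hT.q_comp_add_inner_le hK x y
    have h2 := hT.q_comp_add_inner_le hK y x
    have h3 := real_inner_le_norm (T y - T x) (y - x)
    have h4 := mul_le_mul_of_nonneg_right (hT.norm_sub_le hK.convex y x) (norm_nonneg (y - x))
    rw [inner_sub_left] at h3
    rw [← neg_sub y x, inner_neg_right] at h2
    rw [innerSL_apply_apply, Real.norm_eq_abs, Real.norm_of_nonneg (by positivity), abs_le]
    simp only [Function.comp_apply]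
    constructor <;> nlinarith
  · exact Asymptotics.isLittleO_pow_sub_sub x one_lt_two

end Projector

/-! ### From monotone homogeneous gradients to projectors -/

section Gradient

variable {H : Type*} [NormedAddCommGroup H] [InnerProductSpace ℝ H] {T : H → H}

theorem HasGateauxGradientAt.hasDerivAt {f : H → ℝ} {g x v : H} {t : ℝ}
    (h : HasGateauxGradientAt f g (x + t • v)) :
    HasDerivAt (fun s : ℝ => f (x + s • v)) (inner ℝ g v) t := by
  have h1 : HasDerivAt (fun s : ℝ => f (x + t • v + s • v)) (inner ℝ g v) (t - t) := by
    rw [sub_self]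
    exact h v
  have h2 := h1.comp_sub_const t t
  simpa only [add_assoc, ← add_smul, add_sub_cancel] using h2

/-- The gradient inequality for a function whose Gâteaux gradient is monotone. -/
theorem IsMonotoneOperator.add_inner_le (hmon : IsMonotoneOperator T) {f : H → ℝ}
    (hf : ∀ x, HasGateauxGradientAt f (T x) x) (x y : H) :
    f x + inner ℝ (T x) (y - x) ≤ f y := by
  have hd : ∀ t : ℝ, HasDerivAt (fun s : ℝ => f (x + s • (y - x)))
      (inner ℝ (T (x + t • (y - x))) (y - x)) t := fun t => (hf _).hasDerivAt
  obtain ⟨c, hc, hc'⟩ := exists_hasDerivAt_eq_slope _ _ (zero_lt_one' ℝ)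
    (fun t _ => (hd t).continuousAt.continuousWithinAt) (fun t _ => hd t)
  have h1 := hmon (x + c • (y - x)) x
  rw [add_sub_cancel_left, real_inner_smul_right, inner_sub_left] at h1
  have h2 := nonneg_of_mul_nonneg_right h1 hc.1
  simp only [one_smul, zero_smul, add_zero, add_sub_cancel, sub_zero, div_one] at hc'
  linarith

/-- Euler's identity for `q ∘ T`. -/
theorem IsPosHomogeneous.inner_self (hhom : IsPosHomogeneous T)
    (hf : ∀ x, HasGateauxGradientAt (q ∘ T) (T x) x) (x : H) :
    inner ℝ (T x) x = ‖T x‖ ^ 2 := by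
  have h1 : HasDerivAt (fun s : ℝ => (q ∘ T) (x + s • x)) (inner ℝ (T x) x) 0 := hf x x
  have h2 : HasDerivAt (fun s : ℝ => (1 + s) ^ 2 * q (T x)) (‖T x‖ ^ 2) 0 := by
    refine ((((hasDerivAt_id (0 : ℝ)).const_add 1).pow 2).mul_const (q (T x))).congr_deriv ?_
    simp [q]
  refine h1.unique (h2.congr_of_eventuallyEq ?_)
  -- Homogeneity applies only to `1 + s > 0`.
  filter_upwards [lt_mem_nhds (show (-1 : ℝ) < 0 by norm_num)] with s hs
  have hs' : 0 < 1 + s := by linarith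
  have h3 : x + s • x = (1 + s) • x := by rw [add_smul, one_smul]
  rw [h3, Function.comp_apply, hhom x _ hs', q, q, norm_smul, Real.norm_of_nonneg hs'.le]
  ring

theorem norm_le_of_inner_self {x p : H} (h : inner ℝ p x = ‖p‖ ^ 2) : ‖p‖ ≤ ‖x‖ := by
  have h1 := real_inner_le_norm p x
  by_contra! h2
  have h3 : 0 < ‖p‖ := (norm_nonneg _).trans_lt h2
  nlinarith

/-- Gâteaux differentiability alone does not give continuity; here the gradient inequality in both
directions and `‖T x‖ ≤ ‖x‖` do. -/
theorem IsMonotoneOperator.continuous_q_comp (hmon : IsMonotoneOperator T)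
    (hf : ∀ x, HasGateauxGradientAt (q ∘ T) (T x) x)
    (hself : ∀ x, inner ℝ (T x) x = ‖T x‖ ^ 2) : Continuous (q ∘ T) := by
  refine continuous_iff_continuousAt.2 fun x => ?_
  have hlim : Filter.Tendsto (fun y => (‖x‖ + ‖y‖) * ‖y - x‖) (nhds x) (nhds 0) := by
    have : Continuous fun y => (‖x‖ + ‖y‖) * ‖y - x‖ := by fun_prop
    simpa using this.tendsto x
  refine tendsto_iff_dist_tendsto_zero.2 (squeeze_zero (fun _ => dist_nonneg) (fun y => ?_) hlim)
  have h1 := hmon.add_inner_le hf x y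
  have h2 := hmon.add_inner_le hf y x
  have h3 := neg_le_of_abs_le (abs_real_inner_le_norm (T x) (y - x))
  have h4 := neg_le_of_abs_le (abs_real_inner_le_norm (T y) (x - y))
  rw [norm_sub_rev x y] at h4
  have h5 := mul_le_mul_of_nonneg_right (norm_le_of_inner_self (hself x)) (norm_nonneg (y - x))
  have h6 := mul_le_mul_of_nonneg_right (norm_le_of_inner_self (hself y)) (norm_nonneg (y - x))
  have h7 := mul_nonneg (norm_nonneg x) (norm_nonneg (y - x))
  have h8 := mul_nonneg (norm_nonneg y) (norm_nonneg (y - x))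
  rw [Real.dist_eq, abs_le]
  constructor <;> linarith

/-- Minty's surjectivity theorem for a monotone gradient. -/
theorem IsMonotoneOperator.exists_add_smul_eq [CompleteSpace H] (hmon : IsMonotoneOperator T)
    {f : H → ℝ} (hf : ∀ x, HasGateauxGradientAt f (T x) x) (hcont : Continuous f)
    (hnonneg : ∀ x, 0 ≤ f x) {ε : ℝ} (hε : 0 < ε) (u : H) : ∃ z, T z + ε • z = u := by
  -- The equation is the stationarity condition of this function. Completing the square bounds it
  -- below; convexity of `f` and the parallelogram law give the constant `ε / 4`.
  obtain ⟨z, hz⟩ := exists_forall_le_of_midpoint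
    (g := fun y => f y + ε / 2 * ‖y‖ ^ 2 - inner ℝ u y) (by fun_prop)
    ⟨-(‖u‖ ^ 2 / (2 * ε)), by
      rintro _ ⟨y, rfl⟩
      have h1 := real_inner_le_norm u y
      have h2 := hnonneg y
      have h3 : ε / 2 * ‖y‖ ^ 2 - ‖u‖ * ‖y‖ + ‖u‖ ^ 2 / (2 * ε)
          = (ε * ‖y‖ - ‖u‖) ^ 2 / (2 * ε) := by field_simp; ring
      have h4 : 0 ≤ (ε * ‖y‖ - ‖u‖) ^ 2 / (2 * ε) := by positivity
      simp only
      linarith⟩ (c := ε / 4) (by positivity) (fun a b => by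
      have h1 := hmon.add_inner_le hf ((1 / 2 : ℝ) • (a + b)) a
      have h2 := hmon.add_inner_le hf ((1 / 2 : ℝ) • (a + b)) b
      have h3 : ‖(1 / 2 : ℝ) • (a + b)‖ ^ 2 = (1 / 4) * ‖a + b‖ ^ 2 := by
        rw [norm_smul, mul_pow]
        norm_num
      simp only [h3]
      rw [norm_add_sq_real, norm_sub_sq_real]
      simp only [inner_sub_right, inner_add_right, real_inner_smul_right] at h1 h2 ⊢
      linarith)
  refine ⟨z, ?_⟩
  have hder : ∀ v, inner ℝ (T z) v + ε * inner ℝ z v - inner ℝ u v = 0 := by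
    intro v
    have h1 : HasDerivAt (fun t : ℝ => f (z + t • v)) (inner ℝ (T z) v) 0 := hf z v
    have h2 : HasDerivAt (fun t : ℝ => z + t • v) v 0 := by
      simpa using ((hasDerivAt_id (0 : ℝ)).smul_const v).const_add z
    have h3 := h2.norm_sq
    have h4 := (hasDerivAt_const (0 : ℝ) u).inner ℝ h2
    have h5 := (h1.add (h3.const_mul (ε / 2))).sub h4
    have h6 : IsLocalMin (fun t : ℝ => f (z + t • v) + ε / 2 * ‖z + t • v‖ ^ 2
        - inner ℝ u (z + t • v)) 0 := Filter.Eventually.of_forall fun t => by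
      simpa using hz (z + t • v)
    have h7 := h6.hasDerivAt_eq_zero h5
    simp only [zero_smul, add_zero, inner_zero_left] at h7
    linarith
  refine sub_eq_zero.1 (inner_self_eq_zero (𝕜 := ℝ).1 ?_)
  rw [← hder (T z + ε • z - u), inner_sub_left, inner_add_left, real_inner_smul_left]

/-- If `w ↦ ⟨w, u⟩ - q (T w)` is bounded above, then `u` lies in the closure of the range of
`T`. -/
theorem mem_closure_range_of_inner_le
    (hsurj : ∀ ε : ℝ, 0 < ε → ∀ u, ∃ z, T z + ε • z = u)
    (hself : ∀ x, inner ℝ (T x) x = ‖T x‖ ^ 2) {u : H} {M : ℝ}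
    (hu : ∀ w, inner ℝ u w - q (T w) ≤ M) : u ∈ closure (Set.range T) := by
  have hM : 0 < |M| + 1 := by positivity
  refine Metric.mem_closure_range_iff.2 fun δ hδ => ?_
  -- Here `u - T z = ε • z`, and the bound at `w = z` gives `ε * ‖z‖ ^ 2 ≤ M`, so this `ε` makes `‖ε
  -- • z‖ < δ`.
  obtain ⟨z, hz⟩ := hsurj (δ ^ 2 / (|M| + 1)) (by positivity) u
  set ε := δ ^ 2 / (|M| + 1) with hε
  have hε0 : 0 < ε := by positivity
  refine ⟨z, ?_⟩
  have h1 := hu z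
  rw [← hz, inner_add_left, real_inner_smul_left, hself, real_inner_self_eq_norm_sq] at h1
  have h2 : ε * ‖z‖ ^ 2 < |M| + 1 := by
    have h3 := le_abs_self M
    have h4 := sq_nonneg ‖T z‖
    unfold q at h1
    linarith
  have h5 : (ε * ‖z‖) ^ 2 < δ ^ 2 := by
    calc (ε * ‖z‖) ^ 2 = ε * (ε * ‖z‖ ^ 2) := by ring
      _ < ε * (|M| + 1) := mul_lt_mul_of_pos_left h2 hε0
      _ = δ ^ 2 := by rw [hε]; field_simp
  rw [← hz, dist_eq_norm, add_sub_cancel_left, norm_smul, Real.norm_of_nonneg hε0.le]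
  exact lt_of_pow_lt_pow_left₀ 2 hδ.le h5

theorem exists_isProjectorOnto_of_gradient [CompleteSpace H] (hmon : IsMonotoneOperator T)
    (hhom : IsPosHomogeneous T) (hf : ∀ x, HasGateauxGradientAt (q ∘ T) (T x) x) :
    ∃ K : Set H, IsNonemptyClosedConvexCone K ∧ IsProjectorOnto K T := by
  have hself := hhom.inner_self hf
  have hsurj : ∀ ε : ℝ, 0 < ε → ∀ u, ∃ z, T z + ε • z = u := fun ε hε u =>
    hmon.exists_add_smul_eq hf (hmon.continuous_q_comp hf hself)
      (fun x => by simp only [Function.comp_apply, q]; positivity) hε u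
  have hfenchel : ∀ x y, inner ℝ (T x) y ≤ q (T x) + q (T y) := by
    intro x y
    have h1 := hmon.add_inner_le hf x y
    have h2 : 2 * q (T x) = ‖T x‖ ^ 2 := by unfold q; ring
    rw [inner_sub_right, hself] at h1
    simp only [Function.comp_apply] at h1
    linarith
  refine ⟨closure (Set.range T), ⟨(Set.range_nonempty T).closure, isClosed_closure, ?_, ?_⟩, ?_⟩
  · intro k hk l hl a b ha hb _
    -- By continuity it suffices to place combinations of range points in the closure.
    rw [← closure_closure]
    refine map_mem_closure₂ (f := fun k l : H => a • k + b • l) (by fun_prop) hk hl ?_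
    rintro _ ⟨x, rfl⟩ _ ⟨y, rfl⟩
    refine mem_closure_range_of_inner_le hsurj hself (M := a * q (T x) + b * q (T y))
      fun w => ?_
    have h1 := mul_le_mul_of_nonneg_left (hfenchel x w) ha
    have h2 := mul_le_mul_of_nonneg_left (hfenchel y w) hb
    have h3 : q (T w) = a * q (T w) + b * q (T w) := by rw [← add_mul, ‹a + b = 1›, one_mul]
    rw [inner_add_left, real_inner_smul_left, real_inner_smul_left]
    linarith
  · intro k hk c hc
    refine map_mem_closure (continuous_const_smul c) hk ?_
    rintro _ ⟨x, rfl⟩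
    exact ⟨c • x, hhom x c hc⟩
  · intro x
    refine isNearestPoint_of_inner_le (subset_closure ⟨x, rfl⟩)
      (by rw [real_inner_comm, hself]) fun k hk => ?_
    have hclosed : IsClosed {k : H | inner ℝ x k ≤ q (T x) + q k} :=
      isClosed_le (by fun_prop) (by unfold q; fun_prop)
    refine closure_minimal ?_ hclosed hk
    rintro _ ⟨y, rfl⟩
    -- The roles are swapped: `y` supplies the point `T y` of the range.
    have h1 := hfenchel y x
    rw [real_inner_comm] at h1
    simp only [Set.mem_ofPred_eq]
    linarith

end Gradient

end ProjCone

theorem corollaryc {H : Type*} [NormedAddCommGroup H] [InnerProductSpace ℝ H] [CompleteSpace H]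
    (T : H → H) :
    ((∃ K : Set H, ProjCone.IsNonemptyClosedConvexCone K ∧ ProjCone.IsProjectorOnto K T) ↔
      (ProjCone.IsMonotoneOperator T ∧ ProjCone.IsPosHomogeneous T ∧
        ProjCone.GateauxDifferentiable (ProjCone.q ∘ T) ∧
        ∀ x, ProjCone.HasGateauxGradientAt (ProjCone.q ∘ T) (T x) x)) ∧
    (((∃ K : Set H, ProjCone.IsNonemptyClosedConvexCone K ∧ ProjCone.IsProjectorOnto K T) ∨
      (ProjCone.IsMonotoneOperator T ∧ ProjCone.IsPosHomogeneous T ∧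
        ProjCone.GateauxDifferentiable (ProjCone.q ∘ T) ∧
        ∀ x, ProjCone.HasGateauxGradientAt (ProjCone.q ∘ T) (T x) x)) →
      (ProjCone.IsNonemptyClosedConvexCone (Set.range T) ∧
        ProjCone.IsProjectorOnto (Set.range T) T) ∧
      ∀ K : Set H, ProjCone.IsNonemptyClosedConvexCone K → ProjCone.IsProjectorOnto K T →
        K = Set.range T) := by
  have himp : (ProjCone.IsMonotoneOperator T ∧ ProjCone.IsPosHomogeneous T ∧
      ProjCone.GateauxDifferentiable (ProjCone.q ∘ T) ∧
      ∀ x, ProjCone.HasGateauxGradientAt (ProjCone.q ∘ T) (T x) x) →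
      ∃ K : Set H, ProjCone.IsNonemptyClosedConvexCone K ∧ ProjCone.IsProjectorOnto K T :=
    fun ⟨hmon, hhom, _, hf⟩ => ProjCone.exists_isProjectorOnto_of_gradient hmon hhom hf
  refine ⟨⟨?_, himp⟩, fun h => ⟨?_, fun K _ hT => hT.eq_range⟩⟩
  · rintro ⟨K, hK, hT⟩
    have hf : ∀ x, ProjCone.HasGateauxGradientAt (ProjCone.q ∘ T) (T x) x :=
      fun x v => (hT.hasFDerivAt hK x).hasLineDerivAt v
    exact ⟨hT.isMonotoneOperator hK.convex, hT.isPosHomogeneous hK, fun x => ⟨_, hf x⟩, hf⟩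
  · obtain ⟨K, hK, hT⟩ := h.elim id himp
    rw [← hT.eq_range]
    exact ⟨hK, hT⟩
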